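/- Let $\mathsf X$ be a finite alphabet and let $\operatorname{Aut}\mathsf X^*$ be the group of automorphisms of the rooted tree $\mathsf X^*$ of finite words, in which the children of a word $v$ are the words $vx$, $x\in\mathsf X$. For $g\in\operatorname{Aut}\mathsf X^*$ and $v\in\mathsf X^*$ the restriction $g|_v\in\operatorname{Aut}\mathsf X^*$ is defined by $g(vw)=g(v)\,g|_v(w)$ for all $w\in\mathsf X^*$. A subgroup $G\le\operatorname{Aut}\mathsf X^*$ is self-similar if $g|_x\in G$ for all $g\in G$, $x\in\mathsf X$. It is contracting if there is a finite set $\mathcal N\subset G$ such that for every $g\in G$ there is $k$ with $g|_w\in\mathcal N$ for all words $w$ of length at least $k$; the smallest such $\mathcal N$ is the nucleus. An automorphism $g$ is bounded if its Moore diagram (with vertices the restrictions of $g$ and, for each vertex $q$ and letter $x$, an arrow from $q$ to $q|_x$) is finite and its oriented cycles consisting of non-trivial elements are pairwise disjoint and not connected by directed paths. A self-similar group $G$ is strictly p.c.f. if all its elements are bounded and every element of its nucleus changes at most one letter in every word $w\in\mathsf X^*$. For a subgroup $G\le\operatorname{Aut}\mathsf X^*$, two left-infinite words $\ldots x_2x_1$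 and $\ldots y_2y_1$ in $\mathsf X^{-\omega}$ are asymptotically equivalent if there is a sequence $(g_k)_{k\ge1}$ in $G$ taking only finitely many values with $g_k(x_k\ldots x_1)=y_k\ldots y_1$ for all $k$. The limit space $\mathcal J_G$ is the quotient of $\mathsf X^{-\omega}$ (with the product topology) by this equivalence relation, and $p:\mathsf X^{-\omega}\to\mathcal J_G$ is the quotient map. A self-similar structure on a compact metrizable space $K$ consists of continuous injections $F_i:K\to K$ $(i\in\mathsf X)$ for which there is a continuous surjection $\pi:\mathsf X^{-\omega}\to K$ with $F_i(\pi(\ldots x_2x_1))=\pi(\ldots x_2x_1i)$ for all $i$; it is p.c.f. if its post-critical set $\bigcup_{n\ge1}\sigma^n(\mathcal C)$ is finite, where $\sigma(\ldots x_2x_1)=\ldots x_3x_2$ and $\mathcal C=\pi^{-1}\bigl(\bigcup_{i\ne j}F_i(K)\cap F_j(K)\bigr)$. Corollary. Let $G\le\operatorname{Aut}\mathsf X^*$ be a finitely generated strictly p.c.f. self-similar group. Then $G$ is contracting, its limit space $\mathcal J_G$ (which is compact and metrizable) carries a self-similar structure whose associated surjection $\pi$ is the quotient map $p$, and this self-similar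 structure is p.c.f. -/

import Mathlib

/-! Self-similar groups, their limit spaces, and self-similar structures.

A finite word `x_n … x_2 x_1` is the list `[x_n, …, x_2, x_1]`, read from the left, and a
left-infinite word `… x_2 x_1` is a function `x : ℕ → X` with `x 0 = x_1`, `x 1 = x_2`, …. -/

namespace SelfSim

variable {X : Type*}

/-- The rooted tree `X*`: the root is the empty word, and the children of `v` are the words `vx`. -/
def tree (X : Type*) : SimpleGraph (List X) where
  Adj v w := (∃ x, w = v ++ [x]) ∨ ∃ x, v = w ++ [x]
  symm := ⟨fun _ _ h => h.symm⟩
  loopless := ⟨by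
    rintro v (⟨x, h⟩ | ⟨x, h⟩) <;> simpa using congrArg List.length h⟩

theorem perm_apply_inv {α : Type*} (g : Equiv.Perm α) (a : α) : g (g⁻¹ a) = a :=
  g.apply_symm_apply a

/-- The group `Aut X*` of all automorphisms of the rooted tree `X*`: the permutations of the
vertices that fix the root and preserve adjacency. -/
def TreeAut (X : Type*) : Subgroup (Equiv.Perm (List X)) where
  carrier := {g | g [] = [] ∧ ∀ v w, (tree X).Adj (g v) (g w) ↔ (tree X).Adj v w}
  one_mem' := by simp
  mul_mem' := by
    rintro a b ⟨ha, ha'⟩ ⟨hb, hb'⟩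
    refine ⟨by simp [hb, ha], fun v w => ?_⟩
    rw [Equiv.Perm.mul_apply, Equiv.Perm.mul_apply, ha', hb']
  inv_mem' := by
    rintro a ⟨ha, ha'⟩
    refine ⟨by rw [Equiv.Perm.inv_eq_iff_eq, ha], fun v w => ?_⟩
    rw [← ha', perm_apply_inv, perm_apply_inv]

theorem apply_nil (g : TreeAut X) : g.1 [] = [] := g.2.1

/-- Automorphisms preserve levels and parents. -/
theorem length_and_parent (g : TreeAut X) (n : ℕ) :
    (∀ v : List X, v.length = n → (g.1 v).length = n) ∧
      ∀ (v : List X) (x : X), v.length = n → ∃ y, g.1 (v ++ [x]) = g.1 v ++ [y] := by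
  induction n with
  | zero =>
    refine ⟨fun v hv => ?_, fun v x hv => ?_⟩
    · rw [List.length_eq_zero_iff.1 hv, apply_nil]; rfl
    · rw [List.length_eq_zero_iff.1 hv, apply_nil]
      have h := (g.2.2 [] [x]).2 (Or.inl ⟨x, rfl⟩)
      rw [apply_nil] at h
      rcases h with ⟨y, h⟩ | ⟨y, h⟩
      · exact ⟨y, h⟩
      · simpa using congrArg List.length h
  | succ n ih =>
    have hl : ∀ v : List X, v.length = n + 1 → (g.1 v).length = n + 1 := by
      intro v hv
      rcases List.eq_nil_or_concat' v with rfl | ⟨u, z, rfl⟩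
      · simp at hv
      · have hu : u.length = n := by simpa using hv
        obtain ⟨y, hy⟩ := ih.2 u z hu
        rw [hy, List.length_append, ih.1 u hu]; rfl
    refine ⟨hl, fun v x hv => ?_⟩
    have h := (g.2.2 v (v ++ [x])).2 (Or.inl ⟨x, rfl⟩)
    rcases h with ⟨y, h⟩ | ⟨y, h⟩
    · exact ⟨y, h⟩
    · exfalso
      rcases List.eq_nil_or_concat' v with rfl | ⟨u, z, rfl⟩
      · simp at hv
      · have hu : u.length = n := by simpa using hv
        obtain ⟨y', hy'⟩ := ih.2 u z hu
        rw [hy'] at h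
        have h2 := (List.append_inj' h rfl).1
        have h3 := congrArg List.length (g.1.injective h2)
        simp at h3

theorem length_apply (g : TreeAut X) (v : List X) : (g.1 v).length = v.length :=
  (length_and_parent g v.length).1 v rfl

theorem exists_apply_append (g : TreeAut X) (v w : List X) :
    ∃ u, g.1 (v ++ w) = g.1 v ++ u := by
  induction w using List.reverseRecOn with
  | nil => exact ⟨[], by simp⟩
  | append_singleton w x ih =>
    obtain ⟨u, hu⟩ := ih
    obtain ⟨y, hy⟩ := (length_and_parent g (v ++ w).length).2 (v ++ w) x rfl
    exact ⟨u ++ [y], by rw [← List.append_assoc, hy, hu, List.append_assoc]⟩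

theorem apply_append_drop (g : TreeAut X) (v w : List X) :
    g.1 (v ++ w) = g.1 v ++ (g.1 (v ++ w)).drop v.length := by
  obtain ⟨u, hu⟩ := exists_apply_append g v w
  rw [hu, ← length_apply g v, List.drop_left]

theorem inv_apply_append_drop (g : TreeAut X) (v w : List X) :
    g.1⁻¹ (g.1 v ++ w) = v ++ (g.1⁻¹ (g.1 v ++ w)).drop v.length := by
  have h := apply_append_drop g⁻¹ (g.1 v) w
  rw [length_apply] at h
  simpa using h

/-- The restriction `g|_v`, characterised by `g (v w) = g (v) g|_v (w)`. -/
def restrict (g : TreeAut X) (v : List X) : TreeAut X where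
  val :=
    { toFun := fun w => (g.1 (v ++ w)).drop v.length
      invFun := fun w => (g.1⁻¹ (g.1 v ++ w)).drop v.length
      left_inv := fun w => by
        show (g.1⁻¹ (g.1 v ++ (g.1 (v ++ w)).drop v.length)).drop v.length = w
        rw [← apply_append_drop]; simp
      right_inv := fun w => by
        show (g.1 (v ++ (g.1⁻¹ (g.1 v ++ w)).drop v.length)).drop v.length = w
        rw [← inv_apply_append_drop, perm_apply_inv, ← length_apply g v,
          List.drop_left] }
  property := by
    have key : ∀ a u w : List X, (tree X).Adj (a ++ u) (a ++ w) ↔ (tree X).Adj u w := by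
      intro a u w
      simp [tree, List.append_assoc]
    refine ⟨?_, fun u w => ?_⟩
    · show (g.1 (v ++ [])).drop v.length = []
      simp [length_apply]
    · show (tree X).Adj ((g.1 (v ++ u)).drop v.length) ((g.1 (v ++ w)).drop v.length) ↔ _
      rw [← key (g.1 v), ← apply_append_drop, ← apply_append_drop, g.2.2, key]

theorem apply_append (g : TreeAut X) (v w : List X) :
    g.1 (v ++ w) = g.1 v ++ (restrict g v).1 w :=
  apply_append_drop g v w

/-! ### Bounded automorphisms -/

/-- The states of the Moore diagram of `g`: the set of all restrictions of `g`. In the Moore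
diagram there is, for every state `q` and letter `x`, an arrow from `q` to `q|_x`; this arrow is
represented by the pair `(q, x)`. -/
def states (g : TreeAut X) : Set (TreeAut X) := Set.range (restrict g)

/-- The set of arrows of the directed path in the Moore diagram that starts at `q` and reads the
word `v`. -/
def arrows (q : TreeAut X) (v : List X) : Set (TreeAut X × X) :=
  {e | ∃ u : List X, (u ++ [e.2]) <+: v ∧ e.1 = restrict q u}

/-- The path that starts at `q` and reads the word `v` is an oriented cycle consisting of
non-trivial elements. -/
structure IsNontrivialCycle (q : TreeAut X) (v : List X) : Prop where
  ne_nil : v ≠ []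
  closed : restrict q v = q
  nontrivial : ∀ u : List X, u <+: v → restrict q u ≠ 1

/-- `g` is bounded: its Moore diagram is finite, and its oriented cycles consisting of non-trivial
elements are disjoint and not connected by directed paths; that is, two such cycles joined by a
directed path (labelled by `u`, and possibly of length zero, when the cycles have a vertex in
common) are the same cycle. A cycle is identified with its set of arrows, so that neither its
starting point nor the number of times it is traversed matters. -/
def IsBounded (g : TreeAut X) : Prop :=
  (states g).Finite ∧
    ∀ q ∈ states g, ∀ v : List X, IsNontrivialCycle q v →
      ∀ u w : List X, IsNontrivialCycle (restrict q u) w →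
        arrows q v = arrows (restrict q u) w

/-! ### Self-similar, contracting and strictly p.c.f. groups -/

/-- A group of tree automorphisms is self-similar: for all `g ∈ G` and `x ∈ X` there are `h ∈ G`
and `y ∈ X` with `g (x w) = y h (w)` for all words `w`. -/
def IsSelfSimilar (G : Subgroup (TreeAut X)) : Prop :=
  ∀ g ∈ G, ∀ x : X, ∃ h ∈ G, ∃ y : X, ∀ w : List X, g.1 (x :: w) = y :: h.1 w

/-- `N` is a finite subset of `G` that absorbs all restrictions at long enough words. -/
structure IsAbsorbing (G : Subgroup (TreeAut X)) (N : Set (TreeAut X)) : Prop where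
  finite : N.Finite
  subset : N ⊆ G
  absorbs : ∀ g ∈ G, ∃ k : ℕ, ∀ w : List X, k ≤ w.length → restrict g w ∈ N

/-- The self-similar group `G` is contracting. -/
def IsContracting (G : Subgroup (TreeAut X)) : Prop := ∃ N, IsAbsorbing G N

/-- `N` is the nucleus of `G`: the smallest of the sets in the definition of contraction. -/
def IsNucleus (G : Subgroup (TreeAut X)) (N : Set (TreeAut X)) : Prop :=
  IsLeast {N | IsAbsorbing G N} N

/-- `g` changes at most one letter in every finite word. -/
def ChangesAtMostOneLetter (g : TreeAut X) : Prop :=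
  ∀ w : List X, {i : ℕ | (g.1 w)[i]? ≠ w[i]?}.Subsingleton

/-- `G` is a strictly p.c.f. self-similar group. Contraction is not part of the definition. -/
structure IsStrictlyPCF (G : Subgroup (TreeAut X)) : Prop where
  selfSimilar : IsSelfSimilar G
  bounded : ∀ g ∈ G, IsBounded g
  nucleus : ∀ N, IsNucleus G N → ∀ g ∈ N, ChangesAtMostOneLetter g

/-! ### The limit space -/

/-- The finite word `x_k … x_2 x_1` at the end of the left-infinite word `… x_2 x_1`. -/
def ending (x : ℕ → X) : ℕ → List X
  | 0 => []
  | k + 1 => x k :: ending x k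

/-- The asymptotic equivalence of left-infinite words. -/
def AsympEquiv (G : Subgroup (TreeAut X)) (x y : ℕ → X) : Prop :=
  ∃ g : ℕ → TreeAut X, (∀ k, g k ∈ G) ∧ (Set.range g).Finite ∧
    ∀ k, (g k).1 (ending x k) = ending y k

/-- Asymptotic equivalence is an equivalence relation. -/
def asympSetoid (G : Subgroup (TreeAut X)) : Setoid (ℕ → X) where
  r := AsympEquiv G
  iseqv :=
    { refl := fun x => ⟨fun _ => 1, fun _ => G.one_mem, Set.finite_range_const, fun _ => rfl⟩
      symm := by
        rintro x y ⟨g, hg, hf, h⟩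
        refine ⟨fun k => (g k)⁻¹, fun k => G.inv_mem (hg k), ?_, fun k => ?_⟩
        · refine (hf.image fun a => a⁻¹).subset ?_
          rintro _ ⟨k, rfl⟩
          exact ⟨g k, ⟨k, rfl⟩, rfl⟩
        · rw [← h k]
          exact (g k).1.symm_apply_apply _
      trans := by
        rintro x y z ⟨g, hg, hf, h⟩ ⟨g', hg', hf', h'⟩
        refine ⟨fun k => g' k * g k, fun k => G.mul_mem (hg' k) (hg k), ?_, fun k => ?_⟩
        · refine (hf'.image2 (fun a b => a * b) hf).subset ?_
          rintro _ ⟨k, rfl⟩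
          exact ⟨g' k, ⟨k, rfl⟩, g k, ⟨k, rfl⟩, rfl⟩
        · rw [← h' k, ← h k]; rfl }

/-- The limit space `J_G`: the space of left-infinite words (with the product topology of the
discrete topologies) modulo asymptotic equivalence, with the quotient topology. -/
def LimitSpace (G : Subgroup (TreeAut X)) : Type _ := Quotient (asympSetoid G)

instance [TopologicalSpace X] (G : Subgroup (TreeAut X)) : TopologicalSpace (LimitSpace G) :=
  inferInstanceAs (TopologicalSpace (Quotient (asympSetoid G)))

/-- The quotient map from left-infinite words to the limit space. -/
def limitMap (G : Subgroup (TreeAut X)) : (ℕ → X) → LimitSpace G := Quotient.mk (asympSetoid G)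

/-! ### Self-similar structures -/

/-- The left-infinite word `… x_2 x_1 i`. -/
def appendLetter (i : X) (x : ℕ → X) : ℕ → X
  | 0 => i
  | n + 1 => x n

/-- The shift `… x_2 x_1 ↦ … x_3 x_2`. -/
def shift (x : ℕ → X) : ℕ → X := fun n => x (n + 1)

/-- A self-similar structure on a compact metrizable space `K`: continuous injections `F i` of `K`
together with a continuous surjection `π` from the left-infinite words onto `K` such that
`F i ∘ π = π ∘ i`. -/
structure SelfSimilarStructure (X K : Type*) [TopologicalSpace X] [TopologicalSpace K] where
  F : X → K → K
  π : (ℕ → X) → K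
  compact : CompactSpace K
  metrizable : TopologicalSpace.MetrizableSpace K
  continuous_F : ∀ i, Continuous (F i)
  injective_F : ∀ i, Function.Injective (F i)
  continuous_π : Continuous π
  surjective_π : Function.Surjective π
  comp_eq : ∀ i, F i ∘ π = π ∘ appendLetter i

namespace SelfSimilarStructure

variable {K : Type*} [TopologicalSpace X] [TopologicalSpace K]

/-- The critical set: the preimage under `π` of the union of all `K_i ∩ K_j` with `i ≠ j`, where
`K_i = F_i (K)`. -/
def criticalSet (L : SelfSimilarStructure X K) : Set (ℕ → X) :=
  L.π ⁻¹' ⋃ (i : X) (j : X) (_ : i ≠ j), Set.range (L.F i) ∩ Set.range (L.F j)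

/-- The post-critical set: the union over `n ≥ 1` of the images of the critical set under the
`n`-th iterate of the shift. -/
def postCriticalSet (L : SelfSimilarStructure X K) : Set (ℕ → X) :=
  ⋃ (n : ℕ) (_ : 1 ≤ n), shift^[n] '' L.criticalSet

/-- The self-similar structure is post-critically finite. -/
def IsPCF (L : SelfSimilarStructure X K) : Prop := L.postCriticalSet.Finite

end SelfSimilarStructure

end SelfSim

namespace SelfSim

variable {X : Type*}

/-! Contraction. In a finite bounded automaton a non-trivial state on a cycle has, on each level,
exactly one restriction on a cycle, and its other restrictions are finitary of uniformly bounded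
depth (`IsBoundedAutomaton.exists_word`). For a common multiple `m` of cycle lengths, the generators
therefore restrict eventually, along levels divisible by `m`, into a finite set `core X m` of
finitary and directed automorphisms. A product of two core elements falls back into the core after
`2 * m` letters (`restrict_mul_mem_core`), so the elements with this property form a group, which
contains `G`.

Structure. Through the nucleus, asymptotic equivalence becomes a closed condition on endings
(`IsNucleus.asympEquiv_iff`), so the limit space is metrizable. Deleting the last letter respects
the equivalence, which gives injectivity of the maps. Appending one respects it because a nucleus
element relating two different words has already changed its only letter
(`apply_append_singleton_of_ne`).

Post-critical finiteness. A post-critical word is read along paths in the nucleus that end, for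
every length, in a non-trivial state. Boundedness determines such a word by a nucleus element and
finitely many last letters (`IsNucleus.finite_restrict_ending_ne_one`). -/

open Topology Set TopologicalSpace in
/-- A quotient of a compact, Hausdorff and second countable space by a closed equivalence relation
is metrizable. -/
theorem metrizableSpace_of_isQuotientMap {Y K : Type*} [TopologicalSpace Y] [TopologicalSpace K]
    [CompactSpace Y] [T2Space Y] [SecondCountableTopology Y] {f : Y → K}
    (hf : IsQuotientMap f) (hR : IsClosed {q : Y × Y | f q.1 = f q.2}) :
    MetrizableSpace K := by
  have hcl : IsClosedMap f := by
    intro C hC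
    rw [← hf.isClosed_preimage]
    -- The saturation of a closed set is a projection of a closed subset of `Y × Y` along a compact
    -- factor, hence closed.
    have h : f ⁻¹' (f '' C) = Prod.snd '' ({q : Y × Y | f q.1 = f q.2} ∩ Prod.fst ⁻¹' C) := by
      ext y
      constructor
      · rintro ⟨c, hc, h⟩
        exact ⟨(c, y), ⟨h, hc⟩, rfl⟩
      · rintro ⟨⟨c, y'⟩, ⟨h, hc⟩, rfl⟩
        exact ⟨c, hc, h⟩
    rw [h]
    exact isClosedMap_snd_of_compactSpace _ (hR.inter (hC.preimage continuous_fst))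
  have hker : ∀ {U : Set Y}, IsOpen U → IsOpen (kernImage f U) :=
    fun {U} hU => isClosedMap_iff_kernImage.1 hcl hU
  have hfib : ∀ a : K, IsClosed (f ⁻¹' {a}) := by
    intro a
    obtain ⟨y, rfl⟩ := hf.surjective a
    have : f ⁻¹' {f y} = f ⁻¹' (f '' {y}) := by rw [image_singleton]
    rw [this]
    exact (hcl _ isClosed_singleton).preimage hf.continuous
  have hT2 : T2Space K := by
    refine ⟨fun a b hab => ?_⟩
    obtain ⟨U, V, hU, hV, haU, hbV, hUV⟩ := normal_separation (hfib a) (hfib b)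
      (Disjoint.preimage f (disjoint_singleton.2 hab))
    refine ⟨kernImage f U, kernImage f V, hker hU, hker hV, fun y hy => haU hy,
      fun y hy => hbV hy, disjoint_left.2 fun c hcU hcV => ?_⟩
    obtain ⟨y, rfl⟩ := hf.surjective c
    exact disjoint_left.1 hUV (hcU rfl) (hcV rfl)
  have hcomp : CompactSpace K := hf.surjective.compactSpace hf.continuous
  -- Finite unions of basic sets suffice, because each fibre is compact.
  have hB : IsTopologicalBasis
      ((fun s : Set (Set Y) => kernImage f (⋃₀ s)) '' {s | s.Finite ∧ s ⊆ countableBasis Y}) := by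
    refine isTopologicalBasis_of_isOpen_of_nhds ?_ ?_
    · rintro _ ⟨s, ⟨-, hs⟩, rfl⟩
      exact hker (isOpen_sUnion fun u hu => isOpen_of_mem_countableBasis (hs hu))
    · intro a O ha hO
      have hO' := hO.preimage hf.continuous
      obtain ⟨s, hs, hsf, hsub⟩ := (hfib a).isCompact.elim_finite_subcover_image
        (b := {u | u ∈ countableBasis Y ∧ u ⊆ f ⁻¹' O}) (c := id)
        (fun u hu => isOpen_of_mem_countableBasis hu.1) (by
          intro y hy
          have hy' : y ∈ f ⁻¹' O := by
            rw [mem_preimage, show f y = a from hy]; exact ha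
          obtain ⟨u, hu, hyu, huO⟩ :=
            (isBasis_countableBasis Y).exists_subset_of_mem_open hy' hO'
          exact mem_biUnion (show u ∈ {u | u ∈ countableBasis Y ∧ u ⊆ f ⁻¹' O} from ⟨hu, huO⟩) hyu)
      refine ⟨_, ⟨s, ⟨hsf, fun u hu => (hs hu).1⟩, rfl⟩, fun y hy => ?_, fun c hc => ?_⟩
      · simpa [sUnion_eq_biUnion] using hsub hy
      · obtain ⟨y, rfl⟩ := hf.surjective c
        obtain ⟨u, hu, hyu⟩ := hc rfl
        exact (hs hu).2 hyu
  have : SecondCountableTopology K :=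
    hB.secondCountableTopology
      ((countable_ofPred_finite_subset (countable_countableBasis Y)).image _)
  infer_instance

/-! ### Calculus of restrictions. -/

theorem TreeAut.ext_apply {g h : TreeAut X} (H : ∀ w, g.1 w = h.1 w) : g = h :=
  Subtype.ext (Equiv.ext H)

theorem mul_apply (g h : TreeAut X) (w : List X) : (g * h).1 w = g.1 (h.1 w) := rfl

theorem restrict_eq_of_apply_append {g h : TreeAut X} {v u : List X} (hl : u.length = v.length)
    (H : ∀ w, g.1 (v ++ w) = u ++ h.1 w) : restrict g v = h := by
  refine TreeAut.ext_apply fun w => ?_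
  have h1 := H w
  rw [apply_append] at h1
  exact (List.append_inj h1 (by rw [length_apply, hl])).2

@[simp] theorem restrict_nil (g : TreeAut X) : restrict g [] = g :=
  restrict_eq_of_apply_append (u := []) rfl fun w => by simp

theorem restrict_append (g : TreeAut X) (v w : List X) :
    restrict g (v ++ w) = restrict (restrict g v) w := by
  refine restrict_eq_of_apply_append (u := g.1 v ++ (restrict g v).1 w) ?_ fun z => ?_
  · simp [length_apply]
  · rw [List.append_assoc, apply_append, apply_append, List.append_assoc]

theorem restrict_mul (g h : TreeAut X) (v : List X) :
    restrict (g * h) v = restrict g (h.1 v) * restrict h v := by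
  refine restrict_eq_of_apply_append (u := g.1 (h.1 v)) ?_ fun z => ?_
  · simp [length_apply]
  · rw [mul_apply, apply_append h, apply_append g, mul_apply]

@[simp] theorem restrict_one (v : List X) : restrict (1 : TreeAut X) v = 1 :=
  restrict_eq_of_apply_append (u := v) rfl fun _ => rfl

theorem restrict_inv_apply (g : TreeAut X) (v : List X) :
    restrict g⁻¹ (g.1 v) = (restrict g v)⁻¹ := by
  rw [eq_inv_iff_mul_eq_one, ← restrict_mul, inv_mul_cancel, restrict_one]

theorem apply_inv_apply (g : TreeAut X) (v : List X) : g.1 (g⁻¹.1 v) = v :=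
  perm_apply_inv g.1 v

theorem restrict_inv (g : TreeAut X) (v : List X) :
    restrict g⁻¹ v = (restrict g (g⁻¹.1 v))⁻¹ := by
  rw [← restrict_inv_apply, apply_inv_apply]

theorem IsSelfSimilar.restrict_mem {G : Subgroup (TreeAut X)} (hG : IsSelfSimilar G)
    (v : List X) : ∀ g ∈ G, restrict g v ∈ G := by
  induction v with
  | nil => intro g hg; simpa using hg
  | cons x v ih =>
    intro g hg
    obtain ⟨h, hh, y, H⟩ := hG g hg x
    have : restrict g [x] = h := restrict_eq_of_apply_append (u := [y]) rfl H
    rw [← List.singleton_append, restrict_append, this]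
    exact ih h hh

/-- Two automorphisms coincide if they agree on words of length at most `m` and, at every word of
length `m`, either have the same restriction or both restrict to themselves. -/
theorem eq_of_restrict_eq {g h : TreeAut X} {m : ℕ} (hm : 0 < m)
    (hle : ∀ v : List X, v.length ≤ m → g.1 v = h.1 v)
    (heq : ∀ v : List X, v.length = m →
      restrict g v = restrict h v ∨ (restrict g v = g ∧ restrict h v = h)) : g = h := by
  have key : ∀ n, ∀ w : List X, w.length = n → g.1 w = h.1 w := by
    intro n
    -- If both automorphisms restrict to themselves, the question passes to the word without its
    -- first `m` letters, which is shorter since `0 < m`.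
    induction n using Nat.strong_induction_on with
    | _ n ih =>
      intro w hw
      rcases le_or_gt w.length m with hwm | hwm
      · exact hle w hwm
      · have ht : (w.take m).length = m := by simp [hwm.le]
        rw [← List.take_append_drop m w, apply_append, apply_append, hle _ ht.le]
        rcases heq _ ht with h1 | ⟨h1, h2⟩
        · rw [h1]
        · rw [h1, h2, ih (w.drop m).length (by rw [List.length_drop]; omega) _ rfl]
  exact TreeAut.ext_apply fun w => key _ w rfl

/-! ### Finitary automorphisms -/

/-- The automorphisms that act trivially below level `d`. -/
def finitary (X : Type*) (d : ℕ) : Set (TreeAut X) :=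
  {g | ∀ v : List X, v.length = d → restrict g v = 1}

theorem one_mem_finitary (d : ℕ) : (1 : TreeAut X) ∈ finitary X d := fun v _ => restrict_one v

theorem restrict_eq_one_of_finitary {d : ℕ} {g : TreeAut X} (hg : g ∈ finitary X d) {v : List X}
    (hv : d ≤ v.length) : restrict g v = 1 := by
  rw [← List.take_append_drop d v, restrict_append, hg _ (by simpa using hv), restrict_one]

theorem finitary_mono {d e : ℕ} (h : d ≤ e) : finitary X d ⊆ finitary X e :=
  fun _ hg _ hv => restrict_eq_one_of_finitary hg (hv ▸ h)

theorem restrict_mem_finitary {d : ℕ} {g : TreeAut X} (hg : g ∈ finitary X d) (v : List X) :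
    restrict g v ∈ finitary X d := by
  intro w hw
  rw [← restrict_append]
  exact restrict_eq_one_of_finitary hg (by simp [hw])

theorem mul_mem_finitary {d : ℕ} {g h : TreeAut X} (hg : g ∈ finitary X d)
    (hh : h ∈ finitary X d) : g * h ∈ finitary X d := by
  intro v hv
  rw [restrict_mul, hh v hv, hg _ (by rw [length_apply, hv]), one_mul]

theorem inv_mem_finitary {d : ℕ} {g : TreeAut X} (hg : g ∈ finitary X d) :
    g⁻¹ ∈ finitary X d := by
  intro v hv
  rw [restrict_inv, hg _ (by rw [length_apply, hv]), inv_one]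

/-- The action of an automorphism on the words of length at most `m`. -/
def truncation (m : ℕ) (g : TreeAut X) (v : {v : List X | v.length ≤ m}) :
    {v : List X | v.length ≤ m} :=
  ⟨g.1 v.1, (length_apply g v.1).trans_le v.2⟩

theorem apply_eq_of_truncation_eq {m : ℕ} {g h : TreeAut X}
    (H : truncation m g = truncation m h) (v : List X) (hv : v.length ≤ m) : g.1 v = h.1 v :=
  congrArg Subtype.val (congrFun H ⟨v, hv⟩)

theorem finite_finitary [Finite X] {m : ℕ} (hm : 0 < m) : (finitary X m).Finite := by
  have : Finite {v : List X | v.length ≤ m} := (List.finite_length_le X m).to_subtype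
  refine Set.Finite.of_injOn (Set.mapsTo_univ (truncation m) _) ?_ Set.finite_univ
  intro g hg h hh H
  exact eq_of_restrict_eq hm (apply_eq_of_truncation_eq H)
    fun v hv => Or.inl ((hg v hv).trans (hh v hv).symm)

/-! ### Directed automorphisms -/

/-- The automorphisms that restrict to themselves at the word `v` of length `m`, and to finitary
automorphisms of depth `m` at all other words of length `m`. -/
structure IsDirected (m : ℕ) (v : List X) (g : TreeAut X) : Prop where
  length_eq : v.length = m
  restrict_self : restrict g v = g
  restrict_mem : ∀ w : List X, w.length = m → w ≠ v → restrict g w ∈ finitary X m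

theorem finite_isDirected [Finite X] {m : ℕ} (hm : 0 < m) (v : List X) :
    {g | IsDirected m v g}.Finite := by
  classical
  have h1 : Finite {v : List X | v.length ≤ m} := (List.finite_length_le X m).to_subtype
  have h2 : Finite (finitary X m) := (finite_finitary hm).to_subtype
  let f : {g | IsDirected m v g} →
      ({v : List X | v.length ≤ m} → {v : List X | v.length ≤ m}) ×
        ({v : List X | v.length ≤ m} → finitary X m) := fun g =>
    (truncation m g.1, fun w => if h : w.1.length = m ∧ w.1 ≠ v then
      ⟨restrict g.1 w.1, g.2.restrict_mem w.1 h.1 h.2⟩ else ⟨1, one_mem_finitary m⟩)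
  have hf : Function.Injective f := by
    intro g h H
    refine Subtype.ext (eq_of_restrict_eq hm
      (apply_eq_of_truncation_eq (congrArg Prod.fst H)) fun w hw => ?_)
    by_cases hwv : w = v
    · subst hwv
      exact Or.inr ⟨g.2.restrict_self, h.2.restrict_self⟩
    · left
      have h3 := congrFun (congrArg Prod.snd H) ⟨w, hw.le⟩
      simpa [f, hw, hwv] using h3
  exact Set.finite_coe_iff.1 (Finite.of_injective f hf)

theorem IsDirected.inv {m : ℕ} {v : List X} {g : TreeAut X} (hg : IsDirected m v g) :
    IsDirected m (g.1 v) g⁻¹ where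
  length_eq := by rw [length_apply, hg.length_eq]
  restrict_self := by rw [restrict_inv_apply, hg.restrict_self]
  restrict_mem w hw hwv := by
    rw [restrict_inv]
    refine inv_mem_finitary (hg.restrict_mem _ (by rw [length_apply, hw]) ?_)
    rintro rfl
    exact hwv (apply_inv_apply g w).symm

theorem IsDirected.mul {m : ℕ} {v : List X} {g h : TreeAut X} (hg : IsDirected m (h.1 v) g)
    (hh : IsDirected m v h) : IsDirected m v (g * h) where
  length_eq := hh.length_eq
  restrict_self := by rw [restrict_mul, hg.restrict_self, hh.restrict_self]
  restrict_mem w hw hwv := by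
    rw [restrict_mul]
    exact mul_mem_finitary
      (hg.restrict_mem _ (by rw [length_apply, hw]) fun H => hwv (h.1.injective H))
      (hh.restrict_mem w hw hwv)

/-- The finitary automorphisms of depth `m` together with the directed automorphisms of
period `m`. -/
def core (X : Type*) (m : ℕ) : Set (TreeAut X) :=
  finitary X m ∪ {g | ∃ v, IsDirected m v g}

theorem finite_core [Finite X] {m : ℕ} (hm : 0 < m) : (core X m).Finite := by
  refine (finite_finitary hm).union (Set.Finite.subset (Set.Finite.biUnion
    (List.finite_length_eq X m) fun v _ => finite_isDirected hm v) ?_)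
  rintro g ⟨v, hg⟩
  exact Set.mem_biUnion (show v ∈ {v : List X | v.length = m} from hg.length_eq) hg

theorem inv_mem_core {m : ℕ} {g : TreeAut X} (hg : g ∈ core X m) : g⁻¹ ∈ core X m := by
  rcases hg with hg | ⟨v, hg⟩
  · exact Or.inl (inv_mem_finitary hg)
  · exact Or.inr ⟨_, hg.inv⟩

theorem restrict_mem_core {m : ℕ} {g : TreeAut X} (hg : g ∈ core X m) {v : List X}
    (hv : v.length = m) : restrict g v ∈ core X m := by
  rcases hg with hg | ⟨u, hg⟩
  · exact Or.inl (restrict_mem_finitary hg v)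
  · by_cases hvu : v = u
    · rw [hvu, hg.restrict_self]
      exact Or.inr ⟨u, hg⟩
    · exact Or.inl (hg.restrict_mem v hv hvu)

theorem restrict_mul_mem_core_of_right {m : ℕ} {g h : TreeAut X} (hg : g ∈ core X m)
    (hh : h ∈ finitary X m) {v : List X} (hv : v.length = m) : restrict (g * h) v ∈ core X m := by
  rw [restrict_mul, hh v hv, mul_one]
  exact restrict_mem_core hg (by rw [length_apply, hv])

theorem restrict_mul_mem_core_of_left {m : ℕ} {g h : TreeAut X} (hg : g ∈ finitary X m)
    (hh : h ∈ core X m) {v : List X} (hv : v.length = m) : restrict (g * h) v ∈ core X m := by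
  rw [restrict_mul, hg _ (by rw [length_apply, hv]), one_mul]
  exact restrict_mem_core hh hv

/-- If the directed words of `g` and `h` match along `v`, the product is again directed. Otherwise
at least one factor becomes finitary after the first `m` letters, and the next `m` letters make it
trivial, leaving a restriction of the other factor. -/
theorem restrict_mul_mem_core {m : ℕ} {g h : TreeAut X} (hg : g ∈ core X m) (hh : h ∈ core X m)
    {v w : List X} (hv : v.length = m) (hw : w.length = m) :
    restrict (g * h) (v ++ w) ∈ core X m := by
  rw [restrict_append]
  rcases hh with hh | ⟨b, hh⟩
  · exact restrict_mem_core (restrict_mul_mem_core_of_right hg hh hv) hw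
  by_cases hvb : v = b
  · subst hvb
    rcases hg with hg | ⟨a, hg⟩
    · exact restrict_mem_core (restrict_mul_mem_core_of_left hg (Or.inr ⟨v, hh⟩) hv) hw
    by_cases ha : h.1 v = a
    · subst ha
      exact restrict_mem_core (restrict_mem_core (Or.inr ⟨v, hg.mul hh⟩) hv) hw
    · rw [restrict_mul, hh.restrict_self]
      exact restrict_mul_mem_core_of_left
        (hg.restrict_mem _ (by rw [length_apply, hv]) ha) (Or.inr ⟨v, hh⟩) hw
  · rw [restrict_mul]
    exact restrict_mul_mem_core_of_right (restrict_mem_core hg (by rw [length_apply, hv]))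
      (hh.restrict_mem v hv hvb) hw

/-- The group of automorphisms whose restrictions at sufficiently long words, of length divisible
by `m`, belong to the core. -/
def coreGroup (X : Type*) (m : ℕ) : Subgroup (TreeAut X) where
  carrier := {g | ∃ k : ℕ, ∀ n, k ≤ n → ∀ w : List X, w.length = n * m → restrict g w ∈ core X m}
  one_mem' := ⟨0, fun _ _ w _ => by rw [restrict_one]; exact Or.inl (one_mem_finitary m)⟩
  mul_mem' := by
    rintro g h ⟨k, hg⟩ ⟨l, hh⟩
    -- Two further blocks of `m` letters are what a product of two core elements needs to return to
    -- the core.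
    refine ⟨max k l + 2, fun n hn w hw => ?_⟩
    obtain ⟨n, rfl⟩ : ∃ n', n = n' + 2 := ⟨n - 2, by omega⟩
    rw [Nat.add_mul] at hw
    rw [← List.take_append_drop (n * m) w, restrict_append, restrict_mul]
    have h1 : (w.take (n * m)).length = n * m := by rw [List.length_take]; omega
    have h2 : (w.drop (n * m)).length = 2 * m := by rw [List.length_drop]; omega
    rw [← List.take_append_drop m (w.drop (n * m))]
    refine restrict_mul_mem_core (hg n (by omega) _ (by rw [length_apply, h1]))
      (hh n (by omega) _ h1) ?_ ?_
    · rw [List.length_take]; omega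
    · rw [List.length_drop]; omega
  inv_mem' := by
    rintro g ⟨k, hg⟩
    refine ⟨k, fun n hn w hw => ?_⟩
    rw [restrict_inv]
    exact inv_mem_core (hg n hn _ (by rw [length_apply, hw]))

/-- Restrictions of core elements at words of length at most `m` absorb the lengths not divisible by
`m`. -/
theorem isContracting_of_le_coreGroup [Finite X] {G : Subgroup (TreeAut X)}
    (hG : IsSelfSimilar G) {m : ℕ} (hm : 0 < m) (h : G ≤ coreGroup X m) : IsContracting G := by
  refine ⟨(Set.image2 restrict (core X m) {v | v.length ≤ m}) ∩ G,
    ((finite_core hm).image2 _ (List.finite_length_le X m)).inter_of_left _,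
    Set.inter_subset_right, fun g hg => ?_⟩
  obtain ⟨k, hk⟩ := h hg
  refine ⟨k * m, fun w hw => ⟨?_, hG.restrict_mem w g hg⟩⟩
  have h1 := Nat.div_add_mod' w.length m
  have h2 := Nat.mod_lt w.length hm
  refine ⟨restrict g (w.take (w.length / m * m)),
    hk _ ((Nat.le_div_iff_mul_le hm).2 hw) _ (by rw [List.length_take]; omega),
    w.drop (w.length / m * m), ?_, ?_⟩
  · show (w.drop (w.length / m * m)).length ≤ m
    rw [List.length_drop]; omega
  · rw [← restrict_append, List.take_append_drop]

/-! ### Recurrent states of bounded automorphisms -/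

/-- Non-trivial automorphisms lying on a cycle of their Moore diagram. -/
structure IsRecurrent (q : TreeAut X) : Prop where
  ne_one : q ≠ 1
  exists_restrict : ∃ v : List X, v ≠ [] ∧ restrict q v = q

/-- The trivial state is never left, so a closed path at a non-trivial state avoids it. -/
theorem isNontrivialCycle_of_restrict_eq {q : TreeAut X} (hq : q ≠ 1) {v : List X} (hv : v ≠ [])
    (h : restrict q v = q) : IsNontrivialCycle q v where
  ne_nil := hv
  closed := h
  nontrivial u hu h1 := by
    obtain ⟨t, rfl⟩ := hu
    rw [restrict_append, h1, restrict_one] at h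
    exact hq h.symm

theorem exists_restrict_pow {q : TreeAut X} {v : List X} (h : restrict q v = q) (n : ℕ) :
    ∃ w : List X, w.length = n * v.length ∧ restrict q w = q := by
  induction n with
  | zero => exact ⟨[], by simp⟩
  | succ n ih =>
    obtain ⟨w, hw, hq⟩ := ih
    exact ⟨w ++ v, by rw [List.length_append, hw, Nat.succ_mul], by rw [restrict_append, hq, h]⟩

/-- Going round the cycle often enough gives arbitrarily long words at which `q` restricts to
itself. -/
theorem IsRecurrent.notMem_finitary {q : TreeAut X} (hq : IsRecurrent q) (d : ℕ) :
    q ∉ finitary X d := by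
  intro hd
  obtain ⟨v, hv, h⟩ := hq.exists_restrict
  obtain ⟨w, hw, h'⟩ := exists_restrict_pow h d
  refine hq.ne_one (h'.symm.trans (restrict_eq_one_of_finitary hd ?_))
  rw [hw]
  exact Nat.le_mul_of_pos_right d (List.length_pos_iff.2 hv)

/-- A finite set of bounded automorphisms that is closed under restrictions. -/
structure IsBoundedAutomaton (Q : Set (TreeAut X)) : Prop where
  finite : Q.Finite
  restrict_mem : ∀ q ∈ Q, ∀ v : List X, restrict q v ∈ Q
  bounded : ∀ q ∈ Q, IsBounded q

namespace IsBoundedAutomaton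

variable {Q : Set (TreeAut X)} (hQ : IsBoundedAutomaton Q)
include hQ

/-- Pigeonhole on the `w.length + 1` prefixes of `w`: two of them lead to the same state, which is
non-trivial because the path later ends in a non-trivial state. -/
theorem exists_recurrent {q : TreeAut X} (hq : q ∈ Q) {w : List X} (hw : Q.ncard ≤ w.length)
    (h1 : restrict q w ≠ 1) : ∃ u t : List X, w = u ++ t ∧ IsRecurrent (restrict q u) := by
  have key : ∃ i j : ℕ, i < j ∧ j ≤ w.length ∧
      restrict q (w.take i) = restrict q (w.take j) := by
    have hlt : Q.ncard < (Set.Iic w.length).ncard := by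
      rw [← Finset.coe_Iic, Set.ncard_coe_finset, Nat.card_Iic]
      omega
    obtain ⟨i, hi, j, hj, hij, h⟩ := Set.exists_ne_map_eq_of_ncard_lt_of_maps_to hlt
      (f := fun i => restrict q (w.take i)) (fun i _ => hQ.restrict_mem q hq _) hQ.finite
    rcases lt_or_gt_of_ne hij with hlt | hlt
    · exact ⟨i, j, hlt, hj, h⟩
    · exact ⟨j, i, hlt, hi, h.symm⟩
  obtain ⟨i, j, hij, hj, h⟩ := key
  refine ⟨w.take i, w.drop i, (List.take_append_drop i w).symm, fun h0 => h1 ?_,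
    (w.take j).drop i, ?_, ?_⟩
  · rw [← List.take_append_drop i w, restrict_append, h0, restrict_one]
  · refine List.ne_nil_of_length_pos ?_
    rw [List.length_drop, List.length_take]; omega
  · have : w.take i = (w.take j).take i := by rw [List.take_take, min_eq_left hij.le]
    rw [← restrict_append, this, List.take_append_drop, ← this, h]

/-- The letter is the first one of a shortest cycle at `q`. If another letter `y` led to a
non-finitary state, it would lead on to a second cycle; boundedness identifies the two, so `y` also
starts a closed path at `q`, whose arrows again lie on the shortest cycle. But that cycle leaves `q`
only through its first letter. -/
theorem exists_letter {q : TreeAut X} (hq : q ∈ Q) (hr : IsRecurrent q) :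
    ∃ x : X, IsRecurrent (restrict q [x]) ∧
      ∀ y, y ≠ x → restrict q [y] ∈ finitary X Q.ncard := by
  have hex : ∃ n, ∃ v : List X, v.length = n ∧ v ≠ [] ∧ restrict q v = q :=
    let ⟨v, hv⟩ := hr.exists_restrict
    ⟨_, v, rfl, hv⟩
  classical
  obtain ⟨v, hvl, hv, hvq⟩ := Nat.find_spec hex
  have hmin := fun m => Nat.find_min (m := m) hex
  rw [← hvl] at hmin
  obtain ⟨x, t, rfl⟩ := List.exists_cons_of_ne_nil hv
  have hxt : restrict (restrict q [x]) t = q := by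
    rw [← restrict_append]; exact hvq
  refine ⟨x, ⟨fun h1 => ?_, t ++ [x], by simp, ?_⟩, fun y hy w hw => ?_⟩
  · rw [h1, restrict_one] at hxt
    exact hr.ne_one hxt.symm
  · rw [restrict_append, hxt]
  by_contra hne
  obtain ⟨u, s, -, hu⟩ := hQ.exists_recurrent (hQ.restrict_mem q hq [y]) hw.ge hne
  rw [← restrict_append] at hu
  obtain ⟨c, hc, hcu⟩ := hu.exists_restrict
  have hb := (hQ.bounded q hq).2 q ⟨[], restrict_nil q⟩ (x :: t)
    (isNontrivialCycle_of_restrict_eq hr.ne_one hv hvq)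
  have hx : ((q, x) : TreeAut X × X) ∈ arrows q (x :: t) := ⟨[], ⟨t, rfl⟩, (restrict_nil q).symm⟩
  -- The cycle reached through `y` contains the arrow `(q, x)`, so some prefix `r` of it leads back
  -- to `q`.
  rw [hb _ _ (isNontrivialCycle_of_restrict_eq hu.ne_one hc hcu)] at hx
  obtain ⟨r, -, hr'⟩ := hx
  have hcyc : restrict q (y :: (u ++ r)) = q := by
    rw [← restrict_append] at hr'
    exact hr'.symm
  have hyv : ((q, y) : TreeAut X × X) ∈ arrows q (y :: (u ++ r)) :=
    ⟨[], ⟨u ++ r, rfl⟩, (restrict_nil q).symm⟩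
  have hb' := hb [] (y :: (u ++ r)) (by
    rw [restrict_nil]
    exact isNontrivialCycle_of_restrict_eq hr.ne_one (by simp) hcyc)
  rw [restrict_nil] at hb'
  rw [← hb'] at hyv
  obtain ⟨a, ⟨z, hz⟩, ha⟩ := hyv
  cases a with
  | nil => exact hy (List.cons.inj hz).1
  | cons a0 a =>
    -- An arrow out of `q` at a later position would give a shorter closed word at `q`.
    refine hmin (a0 :: a).length ?_ ⟨_, rfl, by simp, ha.symm⟩
    rw [← hz]; simp

/-- On every level a recurrent state has exactly one recurrent restriction, and all the others
are finitary. -/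
theorem exists_word {q : TreeAut X} (hq : q ∈ Q) (hr : IsRecurrent q) (n : ℕ) :
    ∃ v : List X, v.length = n ∧ IsRecurrent (restrict q v) ∧
      ∀ w : List X, w.length = n → w ≠ v → restrict q w ∈ finitary X Q.ncard := by
  induction n with
  | zero =>
    refine ⟨[], rfl, by rwa [restrict_nil], fun w hw hne => ?_⟩
    exact absurd (List.length_eq_zero_iff.1 hw) hne
  | succ n ih =>
    obtain ⟨v, hv, hrv, H⟩ := ih
    obtain ⟨x, hx, Hx⟩ := hQ.exists_letter (hQ.restrict_mem q hq v) hrv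
    refine ⟨v ++ [x], by simp [hv], by rwa [restrict_append], fun w hw hne => ?_⟩
    rcases List.eq_nil_or_concat' w with rfl | ⟨u, y, rfl⟩
    · simp at hw
    have hu : u.length = n := by simpa using hw
    rw [restrict_append]
    by_cases huv : u = v
    · subst huv
      exact Hx y fun h => hne (by rw [h])
    · exact restrict_mem_finitary (H u hu huv) _

/-- Such a path ends in `1` or passes a recurrent state; from there on `exists_word` decides. -/
theorem finitary_or_recurrent {q : TreeAut X} (hq : q ∈ Q) {w : List X}
    (hw : Q.ncard ≤ w.length) :
    restrict q w ∈ finitary X Q.ncard ∨ IsRecurrent (restrict q w) := by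
  by_cases h1 : restrict q w = 1
  · rw [h1]; exact Or.inl (one_mem_finitary _)
  obtain ⟨u, t, rfl, hu⟩ := hQ.exists_recurrent hq hw h1
  obtain ⟨v, -, hv, H⟩ := hQ.exists_word (hQ.restrict_mem q hq u) hu t.length
  rw [restrict_append]
  by_cases htv : t = v
  · rw [htv]; exact Or.inr hv
  · exact Or.inl (H t rfl htv)

theorem exists_period : ∃ m : ℕ, 0 < m ∧ Q.ncard ≤ m ∧
    ∀ q ∈ Q, IsRecurrent q → ∃ v : List X, v.length = m ∧ restrict q v = q := by
  classical
  have h : ∀ q : TreeAut X, ∃ l : ℕ, 0 < l ∧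
      (IsRecurrent q → ∃ v : List X, v.length = l ∧ restrict q v = q) := by
    intro q
    by_cases hq : IsRecurrent q
    · obtain ⟨v, hv, h⟩ := hq.exists_restrict
      exact ⟨v.length, List.length_pos_iff.2 hv, fun _ => ⟨v, rfl, h⟩⟩
    · exact ⟨1, one_pos, fun h => absurd h hq⟩
  choose l hl hv using h
  have hpos : 0 < ∏ q ∈ hQ.finite.toFinset, l q := Finset.prod_pos fun q _ => hl q
  -- The product is a common multiple of the chosen cycle lengths (`1` for non-recurrent states);
  -- the factor `Q.ncard + 1` makes `m` at least the finitary depth `Q.ncard`.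
  refine ⟨(Q.ncard + 1) * ∏ q ∈ hQ.finite.toFinset, l q, by positivity, ?_, fun q hq hr => ?_⟩
  · exact (Nat.le_succ _).trans (Nat.le_mul_of_pos_right _ hpos)
  · obtain ⟨v, hvl, hvq⟩ := hv q hr
    obtain ⟨c, hc⟩ := Finset.dvd_prod_of_mem l (hQ.finite.mem_toFinset.2 hq)
    obtain ⟨w, hw, hwq⟩ := exists_restrict_pow hvq ((Q.ncard + 1) * c)
    exact ⟨w, by rw [hw, hvl, hc]; ring, hwq⟩

theorem exists_subset_coreGroup : ∃ m : ℕ, 0 < m ∧ Q ⊆ coreGroup X m := by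
  obtain ⟨m, hm, hle, hper⟩ := hQ.exists_period
  refine ⟨m, hm, fun q hq => ⟨Q.ncard, fun n hn w hw => ?_⟩⟩
  have hw' : Q.ncard ≤ w.length := hn.trans (hw ▸ Nat.le_mul_of_pos_right n hm)
  have hqw := hQ.restrict_mem q hq w
  rcases hQ.finitary_or_recurrent hq hw' with h | h
  · exact Or.inl (finitary_mono hle h)
  · obtain ⟨v, hv, hvq⟩ := hper _ hqw h
    obtain ⟨u, hu, -, H⟩ := hQ.exists_word hqw h m
    -- The word of length `m` returning to the state is the exceptional word of that level, since a
    -- recurrent state is not finitary.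
    have huv : v = u := by
      by_contra hne
      have := H v hv hne
      rw [hvq] at this
      exact h.notMem_finitary _ this
    subst huv
    exact Or.inr ⟨v, hv, hvq, fun z hz hzv => finitary_mono hle (H z hz hzv)⟩

end IsBoundedAutomaton

/-- The states of the finitely many generators form a bounded automaton, and a subgroup containing
the generators contains `G`. -/
theorem isContracting_of_bounded [Finite X] {G : Subgroup (TreeAut X)} (hfg : G.FG)
    (hs : IsSelfSimilar G) (hb : ∀ g ∈ G, IsBounded g) : IsContracting G := by
  obtain ⟨S, rfl⟩ := hfg
  have hSG : ∀ s ∈ S, s ∈ Subgroup.closure (S : Set (TreeAut X)) :=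
    fun s hs => Subgroup.subset_closure hs
  have hQ : IsBoundedAutomaton (⋃ s ∈ S, states s) := by
    refine ⟨Set.Finite.biUnion S.finite_toSet fun s hs => (hb s (hSG s hs)).1, ?_, ?_⟩
    · intro q hq v
      obtain ⟨s, hs, u, rfl⟩ := Set.mem_iUnion₂.1 hq
      exact Set.mem_biUnion hs ⟨u ++ v, restrict_append s u v⟩
    · intro q hq
      obtain ⟨s, hs', u, rfl⟩ := Set.mem_iUnion₂.1 hq
      exact hb _ (hs.restrict_mem u s (hSG s hs'))
  obtain ⟨m, hm, h⟩ := hQ.exists_subset_coreGroup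
  refine isContracting_of_le_coreGroup hs hm ((Subgroup.closure_le _).2 fun s hs => h ?_)
  exact Set.mem_biUnion hs ⟨[], restrict_nil s⟩

/-! ### The nucleus -/

theorem IsAbsorbing.inter {G : Subgroup (TreeAut X)} {M N : Set (TreeAut X)}
    (hM : IsAbsorbing G M) (hN : IsAbsorbing G N) : IsAbsorbing G (M ∩ N) where
  finite := hM.finite.inter_of_left N
  subset := Set.inter_subset_left.trans hM.subset
  absorbs g hg := by
    obtain ⟨k, hk⟩ := hM.absorbs g hg
    obtain ⟨l, hl⟩ := hN.absorbs g hg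
    exact ⟨max k l, fun w hw =>
      ⟨hk w ((le_max_left k l).trans hw), hl w ((le_max_right k l).trans hw)⟩⟩

/-- Absorbing sets are closed under binary intersection, so one of minimal cardinality is contained
in all others. -/
theorem IsContracting.exists_nucleus {G : Subgroup (TreeAut X)} (hG : IsContracting G) :
    ∃ N, IsNucleus G N := by
  have hex : ∃ n, ∃ N, IsAbsorbing G N ∧ N.ncard = n :=
    let ⟨N, hN⟩ := hG
    ⟨_, N, hN, rfl⟩
  classical
  obtain ⟨N, hN, hcard⟩ := Nat.find_spec hex
  refine ⟨N, hN, fun M hM => ?_⟩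
  have hle : N.ncard ≤ (N ∩ M).ncard :=
    hcard.trans_le (Nat.find_min' hex ⟨N ∩ M, hN.inter hM, rfl⟩)
  rw [← Set.eq_of_subset_of_ncard_le Set.inter_subset_left hle hN.finite]
  exact Set.inter_subset_right

namespace IsNucleus

variable {G : Subgroup (TreeAut X)} {N : Set (TreeAut X)}

/-- By minimality: the elements of `N` with all restrictions in `N` already form an absorbing set.
-/
theorem restrict_mem (hN : IsNucleus G N) {g : TreeAut X} (hg : g ∈ N) (v : List X) :
    restrict g v ∈ N := by
  have h : IsAbsorbing G {h | h ∈ N ∧ ∀ v, restrict h v ∈ N} := by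
    refine ⟨hN.1.finite.subset fun h hh => hh.1, fun h hh => hN.1.subset hh.1, fun g hg => ?_⟩
    obtain ⟨k, hk⟩ := hN.1.absorbs g hg
    refine ⟨k, fun w hw => ⟨hk w hw, fun v => ?_⟩⟩
    rw [← restrict_append]
    exact hk _ (by rw [List.length_append]; omega)
  exact (hN.2 h hg).2 v

/-- By minimality: the restrictions of `N` at level `n` are absorbing. Hence every nucleus element
ends arbitrarily long paths within the nucleus. -/
theorem exists_restrict_eq [Finite X] (hN : IsNucleus G N) {g : TreeAut X} (hg : g ∈ N) (n : ℕ) :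
    ∃ h ∈ N, ∃ v : List X, v.length = n ∧ restrict h v = g := by
  have h : IsAbsorbing G (Set.image2 restrict N {v | v.length = n}) := by
    refine ⟨hN.1.finite.image2 _ (List.finite_length_eq X n), ?_, fun g hg => ?_⟩
    · rintro _ ⟨h, hh, v, -, rfl⟩
      exact hN.1.subset (hN.restrict_mem hh v)
    · obtain ⟨k, hk⟩ := hN.1.absorbs g hg
      refine ⟨k + n, fun w hw => ⟨restrict g (w.take (w.length - n)), hk _ ?_,
        w.drop (w.length - n), ?_, ?_⟩⟩
      · rw [List.length_take]; omega
      · show (w.drop (w.length - n)).length = n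
        rw [List.length_drop]; omega
      · rw [← restrict_append, List.take_append_drop]
  exact hN.2 h hg

theorem isBoundedAutomaton (hN : IsNucleus G N) (hb : ∀ g ∈ G, IsBounded g) :
    IsBoundedAutomaton N where
  finite := hN.1.finite
  restrict_mem _ hq v := hN.restrict_mem hq v
  bounded q hq := hb q (hN.1.subset hq)

theorem finitary_or_recurrent [Finite X] (hN : IsNucleus G N) (hb : ∀ g ∈ G, IsBounded g)
    {g : TreeAut X} (hg : g ∈ N) : g ∈ finitary X N.ncard ∨ IsRecurrent g := by
  obtain ⟨h, hh, v, hv, rfl⟩ := hN.exists_restrict_eq hg N.ncard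
  exact (hN.isBoundedAutomaton hb).finitary_or_recurrent hh hv.ge

end IsNucleus

/-! ### Endings of left-infinite words -/

@[simp] theorem length_ending (x : ℕ → X) (k : ℕ) : (ending x k).length = k := by
  induction k with
  | zero => rfl
  | succ k ih => simp [ending, ih]

theorem ending_add (x : ℕ → X) (k n : ℕ) :
    ending x (k + n) = ending (shift^[n] x) k ++ ending x n := by
  have hs : ∀ n (x : ℕ → X) k, (shift^[n] x) k = x (k + n) := by
    intro n
    induction n with
    | zero => intro x k; rfl
    | succ n ih => intro x k; rw [Function.iterate_succ_apply, ih]; rfl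
  induction k with
  | zero => simp [ending]
  | succ k ih => rw [Nat.add_right_comm, ending, ih, ending, hs, List.cons_append]

theorem ending_appendLetter (i : X) (x : ℕ → X) (k : ℕ) :
    ending (appendLetter i x) (k + 1) = ending x k ++ [i] := by
  induction k with
  | zero => rfl
  | succ k ih => rw [ending, ih]; rfl

theorem ending_eq_iff {x y : ℕ → X} {k : ℕ} :
    ending x k = ending y k ↔ ∀ i < k, x i = y i := by
  induction k with
  | zero => simp [ending]
  | succ k ih =>
    rw [ending, ending, List.cons.injEq, ih]
    constructor
    · rintro ⟨h1, h2⟩ i hi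
      rcases Nat.lt_succ_iff_lt_or_eq.1 hi with h | rfl
      exacts [h2 i h, h1]
    · exact fun h => ⟨h k k.lt_succ_self, fun i hi => h i (hi.trans k.lt_succ_self)⟩

theorem continuous_ending [TopologicalSpace X] [DiscreteTopology X] (k : ℕ)
    {Y : Type*} [TopologicalSpace Y] [DiscreteTopology Y] (f : List X → Y) :
    Continuous fun x : ℕ → X => f (ending x k) := by
  have h : IsLocallyConstant fun x : ℕ → X => f (ending x k) := by
    refine (IsLocallyConstant.iff_eventually_eq _).2 fun x => ?_
    have hi : ∀ i ∈ Finset.range k, ∀ᶠ y : ℕ → X in nhds x, y i = x i := fun i _ =>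
      ((continuous_apply (A := fun _ : ℕ => X) i).isOpen_preimage {x i}
        (isOpen_discrete _)).mem_nhds rfl
    filter_upwards [(Finset.eventually_all _).2 hi] with y hy
    rw [ending_eq_iff.2 fun i hi => hy i (Finset.mem_range.2 hi)]
  exact h.continuous

/-! ### Asymptotic equivalence through the nucleus -/

/-- The sequence takes finitely many values, so one `K` serves all of them: applied to endings of
length `K + k`, they restrict into `N` after the leading `K` letters. -/
theorem IsNucleus.asympEquiv_iff {G : Subgroup (TreeAut X)} {N : Set (TreeAut X)}
    (hN : IsNucleus G N) {x y : ℕ → X} :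
    AsympEquiv G x y ↔ ∀ k, ∃ h ∈ N, h.1 (ending x k) = ending y k := by
  constructor
  · rintro ⟨g, hg, hfin, H⟩ k
    have hex : ∃ K : ℕ, ∀ a ∈ Set.range g, ∀ w : List X, K ≤ w.length → restrict a w ∈ N := by
      choose K hK using fun a : Set.range g => hN.1.absorbs a.1 (by
        obtain ⟨_, k, rfl⟩ := a
        exact hg k)
      have := hfin.to_subtype
      obtain ⟨M, hM⟩ := (Set.finite_range K).bddAbove
      exact ⟨M, fun a ha w hw => hK ⟨a, ha⟩ w ((hM ⟨⟨a, ha⟩, rfl⟩).trans hw)⟩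
    obtain ⟨K, hK⟩ := hex
    have h1 := H (K + k)
    rw [ending_add, ending_add, apply_append] at h1
    refine ⟨restrict (g (K + k)) (ending (shift^[k] x) K), hK _ ⟨_, rfl⟩ _ (by simp),
      (List.append_inj h1 (by simp [length_apply])).2⟩
  · intro H
    choose g hg H using H
    exact ⟨g, fun k => hN.1.subset (hg k), hN.1.finite.subset (by rintro _ ⟨k, rfl⟩; exact hg k), H⟩

theorem IsNucleus.isClosed_asympEquiv [TopologicalSpace X] [DiscreteTopology X]
    {G : Subgroup (TreeAut X)} {N : Set (TreeAut X)} (hN : IsNucleus G N) :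
    IsClosed {q : (ℕ → X) × (ℕ → X) | limitMap G q.1 = limitMap G q.2} := by
  have h : {q : (ℕ → X) × (ℕ → X) | limitMap G q.1 = limitMap G q.2} =
      ⋂ k, ⋃ h ∈ N, {q | h.1 (ending q.1 k) = ending q.2 k} := by
    ext q
    simp only [Set.mem_ofPred_eq, Set.mem_iInter, Set.mem_iUnion, exists_prop]
    exact Quotient.eq.trans hN.asympEquiv_iff
  rw [h]
  let : TopologicalSpace (List X) := ⊥
  have : DiscreteTopology (List X) := ⟨rfl⟩
  refine isClosed_iInter fun k => hN.1.finite.isClosed_biUnion fun h _ => ?_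
  exact isClosed_eq ((continuous_ending k h.1).comp continuous_fst)
    ((continuous_ending k id).comp continuous_snd)

theorem IsNucleus.metrizableSpace_limitSpace [Finite X] [TopologicalSpace X] [DiscreteTopology X]
    {G : Subgroup (TreeAut X)} {N : Set (TreeAut X)} (hN : IsNucleus G N) :
    TopologicalSpace.MetrizableSpace (LimitSpace G) :=
  metrizableSpace_of_isQuotientMap (f := limitMap G) isQuotientMap_quot_mk hN.isClosed_asympEquiv

/-! ### The maps of the self-similar structure -/

theorem asympEquiv_of_appendLetter {G : Subgroup (TreeAut X)} {N : Set (TreeAut X)}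
    (hN : IsNucleus G N) {i : X} {x y : ℕ → X}
    (h : AsympEquiv G (appendLetter i x) (appendLetter i y)) : AsympEquiv G x y := by
  rw [hN.asympEquiv_iff] at h ⊢
  intro k
  obtain ⟨g, hg, H⟩ := h (k + 1)
  rw [ending_appendLetter, ending_appendLetter, apply_append] at H
  exact ⟨g, hg, (List.append_inj H (by simp [length_apply])).1⟩

/-- The one permitted change already occurs inside `v`, so the last letter is fixed. -/
theorem apply_append_singleton_of_ne {g : TreeAut X} (hg : ChangesAtMostOneLetter g)
    {v u : List X} (hv : g.1 v = u) (hne : u ≠ v) (i : X) : g.1 (v ++ [i]) = u ++ [i] := by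
  obtain ⟨j, hj⟩ := (length_and_parent g v.length).2 v i rfl
  have hlen : u.length = v.length := by rw [← hv, length_apply]
  rw [hj, hv]
  by_contra hij
  have hji : j ≠ i := fun h => hij (by rw [h])
  obtain ⟨a, ha⟩ : ∃ a, u[a]? ≠ v[a]? := by
    by_contra! h
    exact hne (List.ext_getElem? h)
  have hav : a < v.length := by
    by_contra! h
    rw [List.getElem?_eq_none (by omega), List.getElem?_eq_none h] at ha
    exact ha rfl
  have h1 : a = v.length := by
    refine hg (v ++ [i]) ?_ ?_
    · show (g.1 (v ++ [i]))[a]? ≠ (v ++ [i])[a]?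
      rw [hj, hv, List.getElem?_append_left (by omega), List.getElem?_append_left hav]
      exact ha
    · show (g.1 (v ++ [i]))[v.length]? ≠ (v ++ [i])[v.length]?
      rw [hj, hv]
      nth_rw 1 [← hlen]
      simpa using hji
  omega

theorem AsympEquiv.appendLetter {G : Subgroup (TreeAut X)} {N : Set (TreeAut X)}
    (hN : IsNucleus G N) (hc : ∀ g ∈ N, ChangesAtMostOneLetter g) {x y : ℕ → X}
    (h : AsympEquiv G x y) (i : X) : AsympEquiv G (appendLetter i x) (appendLetter i y) := by
  by_cases hxy : x = y
  · rw [hxy]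
    exact (asympSetoid G).refl _
  obtain ⟨j, hj⟩ := Function.ne_iff.1 hxy
  rw [hN.asympEquiv_iff] at h ⊢
  intro k
  -- This length includes position `j`, where `x` and `y` differ; the surplus leading letters are
  -- removed afterwards by a restriction.
  obtain ⟨g, hg, H⟩ := h (j + 1 + k)
  have hne : ending y (j + 1 + k) ≠ ending x (j + 1 + k) :=
    fun h => hj (ending_eq_iff.1 h j (by omega)).symm
  have h1 := apply_append_singleton_of_ne (hc g hg) H hne i
  rw [← ending_appendLetter, ← ending_appendLetter, Nat.add_right_comm,
    ending_add _ (j + 1 + 1) k, ending_add _ (j + 1 + 1) k,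
    apply_append] at h1
  exact ⟨_, hN.restrict_mem hg _, (List.append_inj h1 (by simp [length_apply])).2⟩

/-- The structure on the limit space induced by appending letters. -/
theorem exists_selfSimilarStructure [Finite X] [TopologicalSpace X] [DiscreteTopology X]
    {G : Subgroup (TreeAut X)} {N : Set (TreeAut X)} (hN : IsNucleus G N)
    (hc : ∀ g ∈ N, ChangesAtMostOneLetter g) :
    ∃ L : SelfSimilarStructure X (LimitSpace G), L.π = limitMap G := by
  have hq : Topology.IsQuotientMap (limitMap G) := isQuotientMap_quot_mk
  have happ : ∀ i : X, Continuous (appendLetter i) := fun i => continuous_pi fun n => by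
    cases n with
    | zero => exact continuous_const
    | succ n => exact continuous_apply n
  let F : X → LimitSpace G → LimitSpace G := fun i =>
    Quotient.lift (fun x => limitMap G (appendLetter i x))
      fun _ _ h => Quotient.sound (AsympEquiv.appendLetter hN hc h i)
  refine ⟨{
    F := F
    π := limitMap G
    compact := hq.surjective.compactSpace hq.continuous
    metrizable := hN.metrizableSpace_limitSpace
    continuous_F := fun i => hq.continuous_iff.2 (hq.continuous.comp (happ i))
    injective_F := fun i a b => ?_
    continuous_π := hq.continuous
    surjective_π := hq.surjective
    comp_eq := fun i => rfl }, rfl⟩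
  obtain ⟨x, rfl⟩ := hq.surjective a
  obtain ⟨y, rfl⟩ := hq.surjective b
  exact fun h => Quotient.sound (asympEquiv_of_appendLetter hN (Quotient.exact h))

/-! ### Finiteness of the post-critical set -/

namespace IsNucleus

variable {G : Subgroup (TreeAut X)} {N : Set (TreeAut X)}

/-- Only finitely many left-infinite words are read along the left-infinite paths in the Moore
diagram of the nucleus that avoid the trivial state. -/
theorem finite_restrict_ending_ne_one [Finite X] (hN : IsNucleus G N)
    (hb : ∀ g ∈ G, IsBounded g) :
    {z : ℕ → X | ∀ k, ∃ q ∈ N, restrict q (ending z k) ≠ 1}.Finite := by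
  have hlim : ∀ z : ℕ → X, ∃ q : TreeAut X, (∀ k, ∃ q ∈ N, restrict q (ending z k) ≠ 1) →
      q ∈ N ∧ ∀ᶠ n in (Filter.hyperfilter ℕ : Filter ℕ),
        restrict q (ending z (n + N.ncard)) ≠ 1 := by
    intro z
    by_cases hz : ∀ k, ∃ q ∈ N, restrict q (ending z k) ≠ 1
    · obtain ⟨q, hq, h⟩ := (Ultrafilter.eventually_exists_mem_iff
        (f := Filter.hyperfilter ℕ) hN.1.finite).1
        (Filter.Eventually.of_forall fun n => hz (n + N.ncard))
      exact ⟨q, fun _ => ⟨hq, h⟩⟩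
    · exact ⟨1, fun h => absurd h hz⟩
  choose q hq using hlim
  refine Set.Finite.of_injOn (f := fun z => (q z, ending z N.ncard))
    (t := N ×ˢ {v : List X | v.length = N.ncard})
    (fun z hz => ⟨(hq z hz).1, length_ending z _⟩) ?_
    (hN.1.finite.prod (List.finite_length_eq X _))
  intro z hz z' hz' heq
  obtain ⟨hqq, hend⟩ := Prod.mk.inj heq
  have hmem := (hq z hz).1
  have h1 := (hq z hz).2
  have h2 := (hq z' hz').2
  rw [← hqq] at h2
  have hall : ∀ᶠ n in (Filter.hyperfilter ℕ : Filter ℕ),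
      ending z (n + N.ncard) = ending z' (n + N.ncard) := by
    filter_upwards [h1, h2] with n hn hn'
    rw [ending_add, ending_add, hend, List.append_cancel_right_eq]
    -- The last `N.ncard` letters would trivialize a finitary state, so the leading `n` letters end
    -- in a non-finitary one and thus spell the exceptional word of level `n`.
    have hfin : ∀ w : ℕ → X, restrict (q z) (ending w (n + N.ncard)) ≠ 1 →
        restrict (q z) (ending (shift^[N.ncard] w) n) ∉ finitary X N.ncard := by
      intro w hw hf
      rw [ending_add, restrict_append] at hw
      exact hw (hf _ (length_ending w _))
    rcases hN.finitary_or_recurrent hb hmem with hf | hr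
    · exact absurd (restrict_mem_finitary hf _) (hfin z hn)
    · obtain ⟨v, -, -, H⟩ := (hN.isBoundedAutomaton hb).exists_word hmem hr n
      have huniq : ∀ w : ℕ → X, restrict (q z) (ending w (n + N.ncard)) ≠ 1 →
          ending (shift^[N.ncard] w) n = v := fun w hw => by
        by_contra hne
        exact hfin w hw (H _ (length_ending _ n) hne)
      rw [huniq z hn, huniq z' hn']
  funext i
  obtain ⟨n, hn, hin⟩ := (hall.and ((Filter.tendsto_id.mono_left
    (Nat.hyperfilter_le_atTop)).eventually (Filter.eventually_gt_atTop i))).exists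
  exact ending_eq_iff.1 hn i (hin.trans_le (Nat.le_add_right n _))

end IsNucleus

theorem SelfSimilarStructure.exists_of_mem_criticalSet [TopologicalSpace X]
    {G : Subgroup (TreeAut X)} {L : SelfSimilarStructure X (LimitSpace G)}
    (hL : L.π = limitMap G) {x : ℕ → X} (hx : x ∈ L.criticalSet) :
    ∃ y, AsympEquiv G x y ∧ y 0 ≠ x 0 := by
  obtain ⟨i, hx⟩ := Set.mem_iUnion.1 hx
  obtain ⟨j, hx⟩ := Set.mem_iUnion.1 hx
  obtain ⟨hij, ⟨a, ha⟩, ⟨b, hb⟩⟩ := Set.mem_iUnion.1 hx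
  have key : ∀ (i : X) (a : LimitSpace G), L.F i a = L.π x → ∃ y, AsympEquiv G x y ∧ y 0 = i := by
    intro i a ha
    obtain ⟨y, rfl⟩ := L.surjective_π a
    have h : L.π (appendLetter i y) = L.π x := (congrFun (L.comp_eq i) y).symm.trans ha
    rw [hL] at h
    exact ⟨appendLetter i y, Quotient.exact h.symm, rfl⟩
  -- Of the two distinct letters `i`, `j`, at least one differs from `x 0`.
  by_cases hi : i = x 0
  · obtain ⟨y, hy, hy0⟩ := key j b hb
    exact ⟨y, hy, by rw [hy0, ← hi]; exact hij.symm⟩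
  · obtain ⟨y, hy, hy0⟩ := key i a ha
    exact ⟨y, hy, by rw [hy0]; exact hi⟩

theorem SelfSimilarStructure.isPCF_of_limitMap [Finite X] [TopologicalSpace X]
    {G : Subgroup (TreeAut X)} {N : Set (TreeAut X)} (hN : IsNucleus G N)
    (hb : ∀ g ∈ G, IsBounded g) {L : SelfSimilarStructure X (LimitSpace G)}
    (hL : L.π = limitMap G) : L.IsPCF := by
  refine (hN.finite_restrict_ending_ne_one hb).subset fun z hz => ?_
  obtain ⟨n, hn, x, hx, rfl⟩ := Set.mem_iUnion₂.1 hz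
  obtain ⟨y, hxy, hy⟩ := SelfSimilarStructure.exists_of_mem_criticalSet hL hx
  intro k
  obtain ⟨g, hg, H⟩ := hN.asympEquiv_iff.1 hxy (k + n)
  -- A trivial restriction after the leading `k` letters would make `g` fix the last `n` letters; as
  -- `1 ≤ n`, this includes the last letter, where `x` and `y` differ.
  refine ⟨g, hg, fun h1 => hy ?_⟩
  rw [ending_add, ending_add, apply_append, h1] at H
  exact (ending_eq_iff.1 (List.append_inj H (by simp [length_apply])).2 0 hn).symm

end SelfSim

theorem mainTheorem6 {X : Type*} [Finite X] [TopologicalSpace X] [DiscreteTopology X]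
    (G : Subgroup (SelfSim.TreeAut X)) (hfg : G.FG) (hG : SelfSim.IsStrictlyPCF G) :
    SelfSim.IsContracting G ∧
      (∃ L : SelfSim.SelfSimilarStructure X (SelfSim.LimitSpace G),
        L.π = SelfSim.limitMap G) ∧
      ∀ L : SelfSim.SelfSimilarStructure X (SelfSim.LimitSpace G),
        L.π = SelfSim.limitMap G → L.IsPCF := by
  have hc := SelfSim.isContracting_of_bounded hfg hG.selfSimilar hG.bounded
  obtain ⟨N, hN⟩ := hc.exists_nucleus
  exact ⟨hc, SelfSim.exists_selfSimilarStructure hN (hG.nucleus N hN),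
    fun L hL => SelfSim.SelfSimilarStructure.isPCF_of_limitMap hN hG.bounded hL⟩
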